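/- Let $M$ be a finite monoid. Let $\mathbb{X}(M)=\{aM : a\in M\}$, ordered by inclusion, with the action $b\cdot aM=(ba)M$ of $M$; the set $aM$ represents the R-class $\{c\in M : cM=aM\}$ of $a$. The monoid $M$ is *almost R-trivial* if $ab=b$ for all $a\in M$ and all $b\in M$ whose R-class has more than one element. A *pointed $M$-set* is a set $X$ with an action of $M$ and a distinguished point $x\in X$ such that $Mx=X$. Let $(X_n)_{n\in\mathbb N}$ be a sequence of pointed $M$-sets, possibly overlapping, whose actions agree on common elements. Let $\langle (X_n)\rangle$ be the set of all finite sequences (words) $x_1\cdots x_k$ for which there are $m_1<\cdots<m_k$ with $x_i\in X_{m_i}$ for all $i$; the product of words is concatenation, defined when the result is again in $\langle (X_n)\rangle$, and $a(x_1\cdots x_k)=a(x_1)\cdots a(x_k)$ for $a\in M$. A sequence $(w_i)_{i\in\mathbb N}$ in $\langle (X_n)\rangle$ is *basic* if $w_{i_1}\cdots w_{i_k}$ is defined for all $i_1<\cdots<i_k$. The sequence $(X_n)$ has the *Ramsey property* if for each coloring of $\langle (X_n)\rangle$ with finitely many colors there is a basic sequence $(w_i)$ such that each $w_i$ contains the distinguished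 point of some $X_n$ as an entry, and all words $$a_0(w_{i_0})\cdots a_l(w_{i_l}),\qquad l\in\mathbb N,\ i_0<\cdots<i_l,\ a_0,\dots,a_l\in M,\ a_j=1_M \text{ for at least one } j,$$ have the same color. The monoid $M$ is *Ramsey* if each sequence of pointed $M$-sets has the Ramsey property. (i) If $M$ is almost R-trivial and the partial order $\mathbb{X}(M)$ is linear, then $M$ is Ramsey. (ii) If $\mathbb{X}(M)$ is not linear, then the constant sequence $X_n=\mathbb{X}(M)$, with the action above and with the distinguished point $1_MM$ (the R-class of $1_M$), which is a sequence of pointed $M$-sets, does not have the Ramsey property. Consequently, if $M$ is almost R-trivial, then $M$ is Ramsey if and only if $\mathbb{X}(M)$ is linear. -/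

import Mathlib

universe u v

namespace RamseyMonoid

/-- The principal right ideal `aM` of a monoid `M`. -/
def principalRight {M : Type u} [Monoid M] (a : M) : Set M := Set.range fun m : M => a * m

/-- `M` is almost R-trivial: whenever the R-class of `b`, that is, the set of all `c` with
`bM = cM`, has more than one element, `ab = b` for all `a`. -/
def AlmostRTrivial (M : Type u) [Monoid M] : Prop :=
  ∀ b : M, (∃ c : M, c ≠ b ∧ principalRight b = principalRight c) → ∀ a : M, a * b = b

/-- The set `𝕏(M) = {aM : a ∈ M}`. -/
def XM (M : Type u) [Monoid M] : Type u := {s : Set M // ∃ a : M, principalRight a = s}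

/-- `𝕏(M)` is ordered by inclusion. -/
instance XM.instPartialOrder (M : Type u) [Monoid M] : PartialOrder (XM M) :=
  inferInstanceAs (PartialOrder {s : Set M // ∃ a : M, principalRight a = s})

/-- The element `aM` of `𝕏(M)`, which stands for the R-class of `a`. -/
def XM.mk {M : Type u} [Monoid M] (a : M) : XM M := ⟨principalRight a, a, rfl⟩

theorem image_principalRight {M : Type u} [Monoid M] (b a : M) :
    (fun m : M => b * m) '' principalRight a = principalRight (b * a) := by
  ext x
  simp [principalRight, mul_assoc]

/-- The canonical action of `M` on `𝕏(M)`: an element `b` takes the set `aM` to its left translate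
`b(aM) = (ba)M`. -/
instance XM.instMulAction (M : Type u) [Monoid M] : MulAction M (XM M) where
  smul b s := ⟨(fun m : M => b * m) '' s.1, by
    obtain ⟨a, ha⟩ := s.2
    exact ⟨b * a, by rw [← ha, image_principalRight]⟩⟩
  one_smul s := Subtype.ext (show (fun m : M => 1 * m) '' s.1 = s.1 by simp)
  mul_smul b c s := Subtype.ext
    (show (fun m : M => b * c * m) '' s.1 = (fun m : M => b * m) '' ((fun m : M => c * m) '' s.1) by
      rw [Set.image_image]; simp only [mul_assoc])

/-- `X`, as a subset of a set `Ω` on which `M` acts, is a pointed `M`-set with distinguished point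
`x`, that is, `Mx = X`. (Then `X` contains `x` and is closed under the action.) -/
def IsPointedMSet (M : Type u) [Monoid M] {Ω : Type v} [MulAction M Ω] (X : Set Ω) (x : Ω) : Prop :=
  MulAction.orbit M x = X

/-- `⟨(X_n)⟩`: the finite sequences `x_1 ⋯ x_k` such that, for some `m_1 < ⋯ < m_k`,
`x_i ∈ X_{m_i}` for all `i`. The product of two such sequences is their concatenation, and it is
defined exactly if the concatenation again belongs to `⟨(X_n)⟩`. -/
def words {Ω : Type v} (X : ℕ → Set Ω) : Set (List Ω) :=
  {w | ∃ m : List ℕ, m.Pairwise (· < ·) ∧ List.Forall₂ (fun x n => x ∈ X n) w m}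

/-- `(w_i)` is basic in `⟨(X_n)⟩`: for all `i_1 < ⋯ < i_k`, the product `w_{i_1} ⋯ w_{i_k}` is
defined. The indices are given as a strictly increasing list. -/
def IsBasic {Ω : Type v} (X : ℕ → Set Ω) (w : ℕ → List Ω) : Prop :=
  ∀ s : List ℕ, s.Pairwise (· < ·) → s.flatMap w ∈ words X

/-- The word `a_0(w_{i_0}) ⋯ a_l(w_{i_l})`, where `p` lists the pairs `(i_0, a_0), …, (i_l, a_l)`
and `a(x_1 ⋯ x_k) = a(x_1) ⋯ a(x_k)`. -/
def combination {M : Type u} [Monoid M] {Ω : Type v} [MulAction M Ω] (w : ℕ → List Ω)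
    (p : List (ℕ × M)) : List Ω :=
  p.flatMap fun q => (w q.1).map fun x => q.2 • x

/-- The Ramsey property of a sequence `(X_n)` of pointed `M`-sets with distinguished points `x_n`:
for each finite coloring of `⟨(X_n)⟩` there is a basic sequence `(w_i)` such that each `w_i` has the
distinguished point of some `X_n` as an entry, and all words `a_0(w_{i_0}) ⋯ a_l(w_{i_l})` with
`i_0 < ⋯ < i_l` and with at least one `a_j = 1` get the same color. -/
def HasRamseyProperty (M : Type u) [Monoid M] {Ω : Type v} [MulAction M Ω] (X : ℕ → Set Ω)
    (x : ℕ → Ω) : Prop :=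
  ∀ (r : ℕ) (color : words X → Fin r),
    ∃ w : ℕ → List Ω, IsBasic X w ∧ (∀ i, ∃ n, x n ∈ w i) ∧
      ∃ k : Fin r, ∀ p : List (ℕ × M), p.Pairwise (fun q q' => q.1 < q'.1) →
        (∃ q ∈ p, q.2 = 1) → ∃ h : combination w p ∈ words X, color ⟨combination w p, h⟩ = k

/-- `M` is Ramsey: each sequence of pointed `M`-sets has the Ramsey property. The sets `X_n` of the
sequence may overlap; as words in `⟨(X_n)⟩` are sequences of bare elements, the action of `M` on
words presupposes that the actions on the `X_n` agree on common elements, i.e. that they come from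
one action on a set `Ω` containing all `X_n`. -/
def IsRamsey (M : Type u) [Monoid M] : Prop :=
  ∀ (Ω : Type v) [MulAction M Ω] (X : ℕ → Set Ω) (x : ℕ → Ω),
    (∀ n, IsPointedMSet M (X n) (x n)) → HasRamseyProperty M X x

/-- The partial order `𝕏(M)` is linear. -/
def XMIsLinear (M : Type u) [Monoid M] : Prop := ∀ s t : XM M, s ≤ t ∨ t ≤ s

end RamseyMonoid

/-! Positive direction: `M` acts by continuous endomorphisms on the compact right topological
semigroup of ultrafilters on words. One wants an ultrafilter `p` of words containing distinguished
points, supported on every tail, with `p ≤ φ m p` for all `m`, where `e ≤ f` means `ef = fe = e`.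
`exists_absorbing` builds `p` by climbing the chain of right ideals `aM`, keeping `φ b p ≤ φ (b * m)
p` for `b ∈ aM`. If `a` is not a right zero, almost R-triviality makes its R-class a singleton, so a
step adds only the element `a`. A Galvin–Glazer argument then extracts the sequence from `p`.

Converse: if `aM` and `bM` are incomparable, color a word by which of the two occurs first in it.
Acting by `a` or by `b` on the first word of the sequence forces different colors. -/

namespace RamseyMonoid

open Filter

/-! ### Absorbing elements in compact right topological semigroups -/

section CompactSemigroup

variable {U : Type v} [Semigroup U] [TopologicalSpace U] [CompactSpace U] [T2Space U]

/-- A nonempty closed subsemigroup of a compact right topological semigroup contains a minimal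
idempotent. -/
theorem exists_minimal_idempotent (hc : ∀ r : U, Continuous (· * r)) {K : Set U} (hK : IsClosed K)
    (hne : K.Nonempty) (hmul : ∀ x ∈ K, ∀ y ∈ K, x * y ∈ K) :
    ∃ e ∈ K, e * e = e ∧ ∀ f ∈ K, f * e = f → e * f = f → f * f = f → f = e := by
  -- Any idempotent of a minimal closed left ideal `L` of `K` is a minimal idempotent.
  let 𝒮 : Set (Set U) := {L | IsClosed L ∧ L.Nonempty ∧ L ⊆ K ∧ ∀ k ∈ K, ∀ l ∈ L, k * l ∈ L}
  obtain ⟨L, -, hL⟩ := zorn_superset_nonempty 𝒮 (fun c hcs hch hcn => by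
    refine ⟨⋂₀ c, ⟨isClosed_sInter fun t ht => (hcs ht).1, ?_, ?_, ?_⟩,
      fun s hs => Set.sInter_subset_of_mem hs⟩
    · have := hcn.coe_sort
      rw [Set.sInter_eq_iInter]
      exact IsCompact.nonempty_iInter_of_directed_nonempty_isCompact_isClosed _
        (DirectedOn.directed_val (IsChain.directedOn hch.symm))
        (fun i => (hcs i.2).2.1) (fun i => (hcs i.2).1.isCompact) (fun i => (hcs i.2).1)
    · obtain ⟨t, ht⟩ := hcn
      exact (Set.sInter_subset_of_mem ht).trans (hcs ht).2.2.1
    · exact fun k hk l hl t ht => (hcs ht).2.2.2 k hk l (hl t ht)) K ⟨hK, hne, subset_rfl, hmul⟩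
  obtain ⟨hLc, hLne, hLK, hLmul⟩ := hL.prop
  obtain ⟨e, heL, hee⟩ := exists_idempotent_in_compact_subsemigroup hc L hLne hLc.isCompact
    fun x hx y hy => hLmul x (hLK hx) y hy
  refine ⟨e, hLK heL, hee, fun f hf hfe hef hff => ?_⟩
  have hfL : f ∈ L := hfe ▸ hLmul f hf e heL
  -- `K * f` is a closed left ideal inside `L`, so `e = k * f` for some `k`, whence `e * f = e`.
  have hKf : (· * f) '' K = L := by
    apply hL.eq_of_subset
    · refine ⟨(hc f).isClosedMap _ hK, hne.image _, ?_, ?_⟩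
      · rintro _ ⟨k, hk, rfl⟩
        exact hmul k hk f hf
      · rintro k hk _ ⟨l, hl, rfl⟩
        exact ⟨k * l, hmul k hk l hl, mul_assoc k l f⟩
    · rintro _ ⟨k, hk, rfl⟩
      exact hLmul k hk f hfL
  obtain ⟨k, -, hk⟩ : e ∈ (· * f) '' K := hKf ▸ heL
  calc f = e * f := hef.symm
    _ = e := by rw [← hk]; simp only [mul_assoc, hff]

variable {M : Type u} [Monoid M]

theorem mem_principalRight_self (a : M) : a ∈ principalRight a := ⟨1, mul_one a⟩

theorem mul_mem_principalRight {a b : M} (h : b ∈ principalRight a) (m : M) :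
    b * m ∈ principalRight a := by
  obtain ⟨k, rfl⟩ := h
  exact ⟨k * m, (mul_assoc a k m).symm⟩

theorem principalRight_subset {a b : M} (h : b ∈ principalRight a) :
    principalRight b ⊆ principalRight a := by
  rintro _ ⟨m, rfl⟩
  exact mul_mem_principalRight h m

theorem XMIsLinear.subset_or_subset (hlin : XMIsLinear M) (a b : M) :
    principalRight a ⊆ principalRight b ∨ principalRight b ⊆ principalRight a :=
  hlin (XM.mk a) (XM.mk b)

variable {φ : M → U →ₙ* U} {H I : Set U}

/-- If `a` is a right zero of `M`, then some `p` in a closed ideal has the same image under all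
elements of `aM`, and this image is idempotent. -/
theorem exists_chain_of_right_zero (hc : ∀ r : U, Continuous (· * r))
    (hφc : ∀ a, Continuous (φ a)) (hφ : ∀ a b x, φ (a * b) x = φ a (φ b x))
    (hH : IsClosed H) (hHmul : ∀ x ∈ H, ∀ y ∈ H, x * y ∈ H) (hHφ : ∀ a, ∀ x ∈ H, φ a x ∈ H)
    (hI : IsClosed I) (hIne : I.Nonempty) (hIH : I ⊆ H)
    (hIl : ∀ x ∈ H, ∀ y ∈ I, x * y ∈ I) (hIr : ∀ x ∈ I, ∀ y ∈ H, x * y ∈ I)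
    {a : M} (ha : ∀ b, b * a = a) :
    ∃ p ∈ I, ∀ b ∈ principalRight a, ∀ m,
      φ b p * φ (b * m) p = φ b p ∧ φ (b * m) p * φ b p = φ b p := by
  have ha' : ∀ b ∈ principalRight a, ∀ c, c * b = b := by
    rintro _ ⟨m, rfl⟩ c
    simp only [← mul_assoc, ha]
  -- The common fixed points; elements of `aM` are again right zeros, so they map `H` into `K`.
  let K : Set U := H ∩ ⋂ b : M, {x | φ b x = x}
  have hfix : ∀ b ∈ principalRight a, ∀ x ∈ H, φ b x ∈ K := fun b hb x hx =>
    ⟨hHφ b x hx, Set.mem_iInter.2 fun c => by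
      change φ c (φ b x) = φ b x
      rw [← hφ, ha' b hb]⟩
  obtain ⟨e, ⟨heH, he⟩, hee, hmin⟩ := exists_minimal_idempotent hc (K := K)
    (hH.inter (isClosed_iInter fun b => isClosed_eq (hφc b) continuous_id))
    (by
      obtain ⟨x, hx⟩ := hIne
      exact ⟨φ a x, hfix a (mem_principalRight_self a) x (hIH hx)⟩)
    (by
      rintro x ⟨hx, hx'⟩ y ⟨hy, hy'⟩
      refine ⟨hHmul x hx y hy, Set.mem_iInter.2 fun b => ?_⟩
      have h1 : φ b x = x := Set.mem_iInter.1 hx' b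
      have h2 : φ b y = y := Set.mem_iInter.1 hy' b
      change φ b (x * y) = x * y
      rw [map_mul, h1, h2])
  -- `e` may lie outside `I`; an idempotent `q ∈ I * e` gives the idempotent `e * q ∈ I` below `e`.
  -- Its images under `aM` are fixed idempotents below `e`, hence equal `e` by minimality.
  obtain ⟨_, ⟨x, hx, rfl⟩, hq⟩ := exists_idempotent_in_compact_subsemigroup hc ((· * e) '' I)
    (hIne.image _) (hI.isCompact.image (hc e)) (by
      rintro _ ⟨x, hx, rfl⟩ _ ⟨y, hy, rfl⟩
      exact ⟨x * e * y, hIr _ (hIr x hx e heH) y (hIH hy), mul_assoc (x * e) y e⟩)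
  simp only at hq
  set q := x * e with hqdef
  have hqe : q * e = q := by rw [hqdef, mul_assoc, hee]
  have hqI : q ∈ I := hIr x hx e heH
  have hpI : e * q ∈ I := hIl e heH q hqI
  have hpp : e * q * (e * q) = e * q := by
    rw [mul_assoc, ← mul_assoc q e q, hqe, hq]
  have key : ∀ b ∈ principalRight a, φ b (e * q) = e := fun b hb => by
    have hbe : φ b e = e := Set.mem_iInter.1 he b
    apply hmin _ (hfix b hb _ (hIH hpI))
    · nth_rewrite 2 [← hbe]
      rw [← map_mul, mul_assoc, hqe]
    · nth_rewrite 1 [← hbe]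
      rw [← map_mul, ← mul_assoc, hee]
    · rw [← map_mul, hpp]
  refine ⟨e * q, hpI, fun b hb m => ?_⟩
  rw [key b hb, key _ (mul_mem_principalRight hb m)]
  exact ⟨hee, hee⟩

/-- Passing from the right ideal `amM` to the right ideal `aM = {a} ∪ amM`. -/
theorem exists_chain_step (hc : ∀ r : U, Continuous (· * r))
    (hφc : ∀ a, Continuous (φ a)) (hφ : ∀ a b x, φ (a * b) x = φ a (φ b x))
    (hHφ : ∀ a, ∀ x ∈ H, φ a x ∈ H)
    (hI : IsClosed I) (hIH : I ⊆ H)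
    (hIl : ∀ x ∈ H, ∀ y ∈ I, x * y ∈ I) (hIr : ∀ x ∈ I, ∀ y ∈ H, x * y ∈ I)
    {a m : M} (ham : ∀ b ∈ principalRight a, b = a ∨ b ∈ principalRight (a * m))
    {p : U} (hp : p ∈ I) (h : ∀ b ∈ principalRight (a * m), ∀ k,
      φ b p * φ (b * k) p = φ b p ∧ φ (b * k) p * φ b p = φ b p) :
    ∃ p ∈ I, ∀ b ∈ principalRight a, ∀ k,
      φ b p * φ (b * k) p = φ b p ∧ φ (b * k) p * φ b p = φ b p := by
  -- Changing `p` within `S` preserves what is known on `amM`.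
  let S : Set U := I ∩ ⋂ b ∈ principalRight (a * m), {x | φ b x = φ b p}
  have mem_S : ∀ x, x ∈ S ↔ x ∈ I ∧ ∀ b ∈ principalRight (a * m), φ b x = φ b p := fun x => by
    simp [S]
  have hpS : p ∈ S := (mem_S p).2 ⟨hp, fun _ _ => rfl⟩
  have hSc : IsClosed S := hI.inter <|
    isClosed_iInter fun b => isClosed_iInter fun _ => isClosed_eq (hφc b) continuous_const
  have hidem : ∀ b ∈ principalRight (a * m), φ b p * φ b p = φ b p := fun b hb => by
    simpa using (h b hb 1).1
  have hSmul : ∀ x ∈ S, ∀ y ∈ S, x * y ∈ S := fun x hx y hy => by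
    rw [mem_S] at *
    refine ⟨hIr x hx.1 y (hIH hy.1), fun b hb => ?_⟩
    rw [map_mul, hx.2 b hb, hy.2 b hb, hidem b hb]
  have hmH : φ m p ∈ H := hHφ m p (hIH hp)
  have hSr : ∀ x ∈ S, x * φ m p ∈ S := fun x hx => by
    rw [mem_S] at *
    refine ⟨hIr x hx.1 _ hmH, fun b hb => ?_⟩
    rw [map_mul, ← hφ, hx.2 b hb, (h b hb m).1]
  have hSl : ∀ x ∈ S, φ m p * x ∈ S := fun x hx => by
    rw [mem_S] at *
    refine ⟨hIl _ hmH x hx.1, fun b hb => ?_⟩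
    rw [map_mul, ← hφ, hx.2 b hb, (h b hb m).2]
  -- Since `φ a` sends `φ m p` to `φ (a * m) p = e`, the right factor `φ m p` of `q` gives `φ a q *
  -- e = φ a q`. The new point `φ m p * q` then has image `e * φ a q` under `a`, an idempotent below
  -- `e`.
  obtain ⟨_, ⟨x, hx, rfl⟩, hq⟩ := exists_idempotent_in_compact_subsemigroup hc
    ((· * φ m p) '' S) ⟨_, p, hpS, rfl⟩ (hSc.isCompact.image (hc _)) (by
      rintro _ ⟨x, hx, rfl⟩ _ ⟨y, hy, rfl⟩
      exact ⟨x * φ m p * y, hSmul _ (hSr x hx) y hy, mul_assoc (x * φ m p) y _⟩)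
  simp only at hq
  set q := x * φ m p with hqdef
  have hqS : q ∈ S := hSr x hx
  set e := φ (a * m) p with he
  have hee : e * e = e := hidem _ (mem_principalRight_self _)
  have hae : φ a (φ m p) = e := (hφ a m p).symm
  have hqe : φ a q * e = φ a q := by
    rw [hqdef, map_mul, hae, mul_assoc, hee]
  obtain ⟨hpI, hpb⟩ := (mem_S _).1 (hSl q hqS)
  have hap : φ a (φ m p * q) = e * φ a q := by rw [map_mul, hae]
  refine ⟨φ m p * q, hpI, fun b hb k => ?_⟩
  by_cases hbm : b ∈ principalRight (a * m)
  · rw [hpb b hbm, hpb _ (mul_mem_principalRight hbm k)]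
    exact h b hbm k
  obtain rfl : b = a := (ham b hb).resolve_right hbm
  rw [hap]
  rcases ham (b * k) (mul_mem_principalRight hb k) with hk | hk
  · have hid : e * φ b q * (e * φ b q) = e * φ b q := by
      rw [mul_assoc, ← mul_assoc (φ b q) e, hqe, ← map_mul, hq]
    rw [hk, hap]
    exact ⟨hid, hid⟩
  · rw [hpb _ hk]
    obtain ⟨n, hn⟩ := hk
    have hn' := h (b * m) (mem_principalRight_self _) n
    simp only at hn
    rw [hn, ← he] at hn'
    constructor
    · conv_lhs => rw [← hqe]
      rw [mul_assoc, mul_assoc, hn'.1, hqe]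
    · rw [← mul_assoc, hn'.2]

/-- An almost R-trivial finite monoid with `𝕏(M)` linear, acting by continuous endomorphisms on a
compact right topological semigroup, has, in each closed ideal, an element `p` absorbing all
its images. -/
theorem exists_absorbing [Finite M] (hM : AlmostRTrivial M) (hlin : XMIsLinear M)
    (hc : ∀ r : U, Continuous (· * r))
    (hφc : ∀ a, Continuous (φ a)) (hφ : ∀ a b x, φ (a * b) x = φ a (φ b x))
    (hφ1 : ∀ x, φ 1 x = x)
    (hH : IsClosed H) (hHmul : ∀ x ∈ H, ∀ y ∈ H, x * y ∈ H) (hHφ : ∀ a, ∀ x ∈ H, φ a x ∈ H)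
    (hI : IsClosed I) (hIne : I.Nonempty) (hIH : I ⊆ H)
    (hIl : ∀ x ∈ H, ∀ y ∈ I, x * y ∈ I) (hIr : ∀ x ∈ I, ∀ y ∈ H, x * y ∈ I) :
    ∃ p ∈ I, ∀ m, p * φ m p = p ∧ φ m p * p = p := by
  suffices H : ∀ a : M, ∃ p ∈ I, ∀ b ∈ principalRight a, ∀ m,
      φ b p * φ (b * m) p = φ b p ∧ φ (b * m) p * φ b p = φ b p by
    obtain ⟨p, hp, h⟩ := H 1
    refine ⟨p, hp, fun m => ?_⟩
    simpa [hφ1] using h 1 (mem_principalRight_self 1) m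
  intro a
  induction hn : (principalRight a).ncard using Nat.strong_induction_on generalizing a with
  | _ n ih =>
  by_cases ha : ∀ b, b * a = a
  · exact exists_chain_of_right_zero hc hφc hφ hH hHmul hHφ hI hIne hIH hIl hIr ha
  have hR : ∀ c, principalRight a = principalRight c → c = a := fun c hac => by
    by_contra hne
    exact ha (hM a ⟨c, hne, hac⟩)
  have hne : {c ∈ principalRight a | c ≠ a}.Nonempty := by
    by_contra hemp
    have hsub : ∀ c ∈ principalRight a, c = a := fun c hca => by
      by_contra hca'
      exact hemp ⟨c, hca, hca'⟩
    have hmul : ∀ m, a * m = a := fun m => hsub _ ⟨m, rfl⟩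
    -- When `aM = {a}`, comparing `baM` with `aM` forces `b * a = a`.
    refine ha fun b => ?_
    rcases hlin.subset_or_subset (b * a) a with h | h
    · exact hsub _ (h (mem_principalRight_self _))
    · obtain ⟨m, hm⟩ := h (mem_principalRight_self a)
      simpa [mul_assoc, hmul] using hm
  -- By linearity, the largest ideal generated by an element of `aM` other than `a` contains all
  -- those elements.
  obtain ⟨c, ⟨⟨m, rfl⟩, hca⟩, hmax⟩ := Set.exists_max_image _
    (fun c : M => (principalRight c).ncard) (Set.toFinite _) hne
  simp only at hca hmax
  have hsub : principalRight (a * m) ⊆ principalRight a := principalRight_subset ⟨m, rfl⟩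
  have hlt : (principalRight (a * m)).ncard < n := by
    rw [← hn]
    refine Set.ncard_lt_ncard (hsub.ssubset_of_ne fun heq => hca (hR _ heq.symm)) (Set.toFinite _)
  obtain ⟨p, hp, h⟩ := ih _ hlt (a * m) rfl
  refine exists_chain_step hc hφc hφ hHφ hI hIH hIl hIr (fun b hb => ?_) hp h
  by_cases hba : b = a
  · exact Or.inl hba
  refine Or.inr ?_
  rcases hlin.subset_or_subset b (a * m) with hs | hs
  · exact hs (mem_principalRight_self b)
  · rw [Set.eq_of_subset_of_ncard_le hs (hmax b ⟨hb, hba⟩) (Set.toFinite _)]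
    exact mem_principalRight_self b

end CompactSemigroup

/-! ### Ultrafilters on words and extraction of sequences -/

/-- Words form a semigroup under concatenation. -/
@[reducible] def listSemigroup (Ω : Type v) : Semigroup (List Ω) where
  mul := (· ++ ·)
  mul_assoc := List.append_assoc

attribute [local instance] listSemigroup Ultrafilter.mul Ultrafilter.semigroup

section Ultrafilters

variable {M : Type u} [Monoid M] {Ω : Type v} [MulAction M Ω]

theorem continuous_ultrafilter_map {α β : Type*} (f : α → β) :
    Continuous (Ultrafilter.map f) :=
  ultrafilterBasis_is_basis.continuous_iff.2 <| Set.forall_mem_range.mpr fun s =>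
    ultrafilter_isOpen_basic (f ⁻¹' s)

theorem eventually_list_mul (p q : Ultrafilter (List Ω)) (P : List Ω → Prop) :
    (∀ᶠ w in ((p * q : Ultrafilter (List Ω)) : Filter (List Ω)), P w) ↔
      ∀ᶠ u in (p : Filter (List Ω)), ∀ᶠ v in (q : Filter (List Ω)), P (u ++ v) :=
  Iff.rfl

/-- The action of `M` on ultrafilters of words. -/
def wordMap (a : M) : Ultrafilter (List Ω) →ₙ* Ultrafilter (List Ω) where
  toFun := Ultrafilter.map (List.map (a • ·))
  map_mul' p q := Ultrafilter.coe_inj.mp <| Filter.ext' fun P => by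
    simp only [Ultrafilter.coe_map, eventually_map, eventually_list_mul, List.map_append]

theorem eventually_wordMap (a : M) (p : Ultrafilter (List Ω)) (P : List Ω → Prop) :
    (∀ᶠ w in (wordMap a p : Filter (List Ω)), P w) ↔
      ∀ᶠ w in (p : Filter (List Ω)), P (w.map (a • ·)) :=
  Iff.rfl

theorem wordMap_mul (a b : M) (p : Ultrafilter (List Ω)) :
    wordMap (a * b) p = wordMap a (wordMap b p) :=
  Ultrafilter.coe_inj.mp <| Filter.ext' fun P => by
    simp [eventually_wordMap, mul_smul, Function.comp_def]

theorem wordMap_one (p : Ultrafilter (List Ω)) : wordMap (1 : M) p = p :=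
  Ultrafilter.coe_inj.mp <| Filter.ext' fun P => by
    simp [eventually_wordMap]

/-- Writing `a = b * m` or `b = a * m`, apply the endomorphism of the larger ideal's generator to
the absorption identities. -/
theorem wordMap_mul_wordMap (hlin : XMIsLinear M) {p : Ultrafilter (List Ω)}
    (hp : ∀ m : M, p * wordMap m p = p ∧ wordMap m p * p = p) (a b : M) :
    wordMap a p * wordMap b p = wordMap a p ∨ wordMap a p * wordMap b p = wordMap b p := by
  rcases hlin.subset_or_subset a b with h | h
  · obtain ⟨m, rfl⟩ := h (mem_principalRight_self a)
    right
    rw [wordMap_mul, ← map_mul, (hp m).2]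
  · obtain ⟨m, rfl⟩ := h (mem_principalRight_self b)
    left
    rw [wordMap_mul, ← map_mul, (hp m).1]

/-- Extraction of a sequence along an ultrafilter: if `E` and `G` are stable under appending images
of almost all words, and appending almost all words leads from `E` to `G`, then there is a sequence
all of whose combinations that involve `1` lie in `G`. -/
theorem exists_sequence [Finite M] {p : Ultrafilter (List Ω)} {D E G : Set (List Ω)}
    (hD : ∀ᶠ v in (p : Filter (List Ω)), v ∈ D) (hE : [] ∈ E)
    (hEG : ∀ u ∈ E, ∀ᶠ v in (p : Filter (List Ω)), u ++ v ∈ G)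
    (hEE : ∀ u ∈ E, ∀ m : M, ∀ᶠ v in (p : Filter (List Ω)), u ++ v.map (m • ·) ∈ E)
    (hGG : ∀ u ∈ G, ∀ m : M, ∀ᶠ v in (p : Filter (List Ω)), u ++ v.map (m • ·) ∈ G) :
    ∃ w : ℕ → List Ω, (∀ i, w i ∈ D) ∧ ∀ l : List (ℕ × M),
      l.Pairwise (fun q q' => q.1 < q'.1) → (∃ q ∈ l, q.2 = 1) → combination w l ∈ G := by
  -- The first component collects all combinations so far, the second those already involving `1`.
  let State := {s : Set (List Ω) × Set (List Ω) // s.1.Finite ∧ s.2.Finite ∧ s.1 ⊆ E ∧ s.2 ⊆ G}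
  have hnext : ∀ s : State, ∃ v, v ∈ D ∧ (∀ u ∈ s.1.1, u ++ v ∈ G) ∧
      (∀ u ∈ s.1.1, ∀ m : M, u ++ v.map (m • ·) ∈ E) ∧
      ∀ u ∈ s.1.2, ∀ m : M, u ++ v.map (m • ·) ∈ G := by
    rintro ⟨⟨A, B⟩, hA, hB, hAE, hBG⟩
    have h1 := (eventually_all_finite hA).2 fun u hu => hEG u (hAE hu)
    have h2 := (eventually_all_finite hA).2 fun u hu => eventually_all.2 (hEE u (hAE hu))
    have h3 := (eventually_all_finite hB).2 fun u hu => eventually_all.2 (hGG u (hBG hu))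
    obtain ⟨v, hv⟩ := (hD.and (h1.and (h2.and h3))).exists
    exact ⟨v, hv⟩
  choose f hfD hf1 hf2 hf3 using hnext
  let next : State → State := fun s =>
    ⟨(s.1.1 ∪ Set.image2 (fun u (m : M) => u ++ (f s).map (m • ·)) s.1.1 Set.univ,
      s.1.2 ∪ ((· ++ f s) '' s.1.1 ∪
        Set.image2 (fun u (m : M) => u ++ (f s).map (m • ·)) s.1.2 Set.univ)),
      s.2.1.union (s.2.1.image2 _ Set.finite_univ),
      s.2.2.1.union ((s.2.1.image _).union (s.2.2.1.image2 _ Set.finite_univ)),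
      Set.union_subset s.2.2.2.1 (Set.image2_subset_iff.2 fun u hu m _ => hf2 s u hu m),
      Set.union_subset s.2.2.2.2 (Set.union_subset (Set.image_subset_iff.2 fun u hu => hf1 s u hu)
        (Set.image2_subset_iff.2 fun u hu m _ => hf3 s u hu m))⟩
  let start : State := ⟨({[]}, ∅), Set.finite_singleton _, Set.finite_empty,
    Set.singleton_subset_iff.2 hE, Set.empty_subset _⟩
  let st : ℕ → State := fun n => next^[n] start
  have hst : ∀ n, st (n + 1) = next (st n) := fun n => Function.iterate_succ_apply' next n start
  have mono1 : Monotone fun n => (st n).1.1 := monotone_nat_of_le_succ fun n => by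
    rw [hst]; exact Set.subset_union_left
  have mono2 : Monotone fun n => (st n).1.2 := monotone_nat_of_le_succ fun n => by
    rw [hst]; exact Set.subset_union_left
  have key : ∀ l : List (ℕ × M), l.Pairwise (fun q q' => q.1 < q'.1) → ∀ n, (∀ q ∈ l, q.1 < n) →
      combination (fun i => f (st i)) l ∈ (st n).1.1 ∧
      ((∃ q ∈ l, q.2 = 1) → combination (fun i => f (st i)) l ∈ (st n).1.2) := by
    intro l
    induction l using List.reverseRecOn with
    | nil =>
      intro _ n _
      exact ⟨mono1 (Nat.zero_le n) (Set.mem_singleton _), by simp⟩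
    | append_singleton l q ih =>
      intro hl n hn
      obtain ⟨hl1, -, hl2⟩ := List.pairwise_append.1 hl
      obtain ⟨ih1, ih2⟩ := ih hl1 q.1 fun q' hq' => hl2 q' hq' q (List.mem_singleton_self q)
      have hcomb : combination (fun i => f (st i)) (l ++ [q]) =
          combination (fun i => f (st i)) l ++ (f (st q.1)).map (q.2 • ·) := by
        simp [combination]
      have hqn : q.1 + 1 ≤ n := hn q (by simp)
      rw [hcomb]
      refine ⟨mono1 hqn ?_, fun hex => mono2 hqn ?_⟩
      · simp only [hst]
        exact Or.inr (Set.mem_image2_of_mem ih1 (Set.mem_univ _))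
      · simp only [hst]
        obtain ⟨q', hq', h1⟩ := hex
        rcases List.mem_append.1 hq' with hq' | hq'
        · exact Or.inr (Or.inr (Set.mem_image2_of_mem (ih2 ⟨q', hq', h1⟩) (Set.mem_univ _)))
        · obtain rfl := List.mem_singleton.1 hq'
          refine Or.inr (Or.inl ⟨_, ih1, ?_⟩)
          simp [h1]
  refine ⟨fun i => f (st i), fun i => hfD _, fun l hl hex => ?_⟩
  obtain ⟨N, hN⟩ := (l.map Prod.fst).toFinset.bddAbove
  refine (st (N + 1)).2.2.2.2 ((key l hl (N + 1) fun q hq => Nat.lt_succ_of_le (hN ?_)).2 hex)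
  simpa using ⟨q.2, hq⟩

/-- An ultrafilter absorbing all its images yields sequences with all combinations that involve `1`
in a prescribed set of the ultrafilter. -/
theorem exists_sequence_of_absorbing [Finite M] (hlin : XMIsLinear M) {p : Ultrafilter (List Ω)}
    (hp : ∀ m : M, p * wordMap m p = p ∧ wordMap m p * p = p) {C D : Set (List Ω)}
    (hC : ∀ᶠ v in (p : Filter (List Ω)), v ∈ C) (hD : ∀ᶠ v in (p : Filter (List Ω)), v ∈ D) :
    ∃ w : ℕ → List Ω, (∀ i, w i ∈ D) ∧ ∀ l : List (ℕ × M),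
      l.Pairwise (fun q q' => q.1 < q'.1) → (∃ q ∈ l, q.2 = 1) → combination w l ∈ C := by
  -- One step of lookahead suffices in `G`: a product of two images of `p` is again one of them.
  let G : Set (List Ω) := {u | u ∈ C ∧ ∀ m : M, ∀ᶠ v in (p : Filter (List Ω)),
    u ++ v.map (m • ·) ∈ C}
  let E : Set (List Ω) := {u | ∀ᶠ v in (p : Filter (List Ω)), u ++ v ∈ G}
  have hG : ∀ᶠ u in (p : Filter (List Ω)), u ∈ G := by
    refine hC.and (eventually_all.2 fun m => ?_)
    have h := hC
    rw [← (hp m).1, eventually_list_mul] at h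
    exact h
  have hEE : ∀ u ∈ E, ∀ m : M, ∀ᶠ v in (p : Filter (List Ω)), u ++ v.map (m • ·) ∈ E := by
    intro u hu m
    have h : ∀ᶠ v in (p : Filter (List Ω)), u ++ v ∈ G := hu
    rw [← (hp m).2, eventually_list_mul, eventually_wordMap] at h
    simpa only [E, Set.mem_ofPred_eq, List.append_assoc] using h
  have hGG : ∀ u ∈ G, ∀ m : M, ∀ᶠ v in (p : Filter (List Ω)), u ++ v.map (m • ·) ∈ G := by
    rintro u ⟨-, hu⟩ m
    refine (hu m).and (eventually_all.2 fun m' => ?_)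
    have h : ∀ᶠ v in ((wordMap m p * wordMap m' p : Ultrafilter (List Ω)) : Filter (List Ω)),
        u ++ v ∈ C := by
      rcases wordMap_mul_wordMap hlin hp m m' with h | h
      · rw [h]; exact hu m
      · rw [h]; exact hu m'
    rw [eventually_list_mul, eventually_wordMap] at h
    simpa only [eventually_wordMap, List.append_assoc] using h
  obtain ⟨w, hw, h⟩ := exists_sequence hD hG (fun u hu => hu) hEE hGG
  exact ⟨w, hw, fun l hl hex => (h l hl hex).1⟩

/-! ### Tails and the positive direction -/

/-- The words in `⟨(X_n)⟩` that use only the sets `X_n` with `n ≥ N`. -/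
def tailWords (X : ℕ → Set Ω) (N : ℕ) : Set (List Ω) :=
  {w | ∃ m : List ℕ, (m.Pairwise (· < ·) ∧ ∀ n ∈ m, N ≤ n) ∧
    List.Forall₂ (fun x n => x ∈ X n) w m}

theorem exists_append_mem_tailWords {X : ℕ → Set Ω} {N : ℕ} {u : List Ω} (hu : u ∈ tailWords X N) :
    ∃ K, ∀ v ∈ tailWords X K, u ++ v ∈ tailWords X N := by
  obtain ⟨m, ⟨hm, hN⟩, hum⟩ := hu
  obtain ⟨K, hK⟩ := m.toFinset.bddAbove
  have hK' : ∀ n ∈ m, n ≤ K := fun n hn => hK (by simpa using hn)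
  refine ⟨max N (K + 1), ?_⟩
  rintro v ⟨m', ⟨hm', hN'⟩, hvm⟩
  refine ⟨m ++ m', ⟨List.pairwise_append.2 ⟨hm, hm', fun a ha b hb => ?_⟩, fun n hn => ?_⟩,
    List.rel_append hum hvm⟩
  · have := hK' a ha
    have := hN' b hb
    omega
  · rcases List.mem_append.1 hn with hn | hn
    · exact hN n hn
    · exact (le_max_left _ _).trans (hN' n hn)

theorem smul_mem_tailWords {X : ℕ → Set Ω} (hX : ∀ n, ∀ x ∈ X n, ∀ a : M, a • x ∈ X n) {N : ℕ}
    {u : List Ω} (hu : u ∈ tailWords X N) (a : M) : u.map (a • ·) ∈ tailWords X N := by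
  obtain ⟨m, hm, hum⟩ := hu
  refine ⟨m, hm, List.forall₂_map_left_iff.2 (hum.imp fun x n hx => hX n x hx a)⟩

theorem tailWords_subset_words (X : ℕ → Set Ω) (N : ℕ) : tailWords X N ⊆ words X :=
  fun _ ⟨m, hm, h⟩ => ⟨m, hm.1, h⟩

/-- The positive direction: linearity of `𝕏(M)` suffices for almost R-trivial monoids. -/
theorem isRamsey_of_linear [Finite M] (hM : AlmostRTrivial M) (hlin : XMIsLinear M) :
    IsRamsey.{u, v} M := by
  intro Ω _ X x hX r color
  have hXmem : ∀ n, x n ∈ X n := fun n => by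
    rw [← hX n]; exact MulAction.mem_orbit_self _
  have hXsmul : ∀ n, ∀ y ∈ X n, ∀ a : M, a • y ∈ X n := fun n y hy a => by
    have h := hX n
    unfold IsPointedMSet at h
    rw [← h] at hy ⊢
    exact MulAction.mem_orbit_of_mem_orbit a hy
  let D : Set (List Ω) := {w | ∃ n, x n ∈ w}
  let H : Set (Ultrafilter (List Ω)) := ⋂ N, {p | tailWords X N ∈ p}
  let I : Set (Ultrafilter (List Ω)) := H ∩ {p | D ∈ p}
  have memH : ∀ p : Ultrafilter (List Ω), p ∈ H ↔
      ∀ N, ∀ᶠ w in (p : Filter (List Ω)), w ∈ tailWords X N := fun p => Set.mem_iInter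
  have hHc : IsClosed H := isClosed_iInter fun N => ultrafilter_isClosed_basic _
  have hHmul : ∀ p ∈ H, ∀ q ∈ H, p * q ∈ H := fun p hp q hq => by
    rw [memH] at *
    intro N
    rw [eventually_list_mul]
    filter_upwards [hp N] with u hu
    obtain ⟨K, hK⟩ := exists_append_mem_tailWords hu
    filter_upwards [hq K] with v hv using hK v hv
  obtain ⟨p, ⟨hpH, hpD⟩, hp⟩ := exists_absorbing (U := Ultrafilter (List Ω)) (φ := wordMap)
    (H := H) (I := I) hM hlin Ultrafilter.continuous_mul_left
    (fun a => continuous_ultrafilter_map _) wordMap_mul wordMap_one hHc hHmul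
    (fun a p hp => by
      rw [memH] at *
      intro N
      rw [eventually_wordMap]
      filter_upwards [hp N] with u hu using smul_mem_tailWords hXsmul hu a)
    (hHc.inter (ultrafilter_isClosed_basic D))
    (by
      -- One-letter words along a nonprincipal ultrafilter lie in every tail.
      refine ⟨Ultrafilter.map (fun n => [x n]) (hyperfilter ℕ), (memH _).2 fun N => ?_,
        Filter.Eventually.of_forall fun n => ⟨n, List.mem_singleton_self _⟩⟩
      have h : ∀ᶠ n in (hyperfilter ℕ : Filter ℕ), N ≤ n :=
        Nat.hyperfilter_le_atTop (eventually_ge_atTop N)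
      refine h.mono fun n hn => ⟨[n], by simpa using hn, by simpa using hXmem n⟩)
    Set.inter_subset_left
    (fun p hp q hq => ⟨hHmul p hp q hq.1, Filter.Eventually.of_forall fun u => by
      have h : ∀ᶠ v in (q : Filter (List Ω)), v ∈ D := hq.2
      exact h.mono fun v ⟨n, hn⟩ => ⟨n, List.mem_append_right u hn⟩⟩)
    (fun p hp q hq => ⟨hHmul p hp.1 q hq, by
      have h : ∀ᶠ v in (p : Filter (List Ω)), v ∈ D := hp.2
      exact h.mono fun u ⟨n, hn⟩ => Filter.Eventually.of_forall fun v =>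
        ⟨n, List.mem_append_left v hn⟩⟩)
  obtain ⟨k, hk⟩ : ∃ k : Fin r, ∀ᶠ w in (p : Filter (List Ω)),
      ∃ h : w ∈ words X, color ⟨w, h⟩ = k := by
    have h : ∀ᶠ w in (p : Filter (List Ω)), ∃ k : Fin r, ∃ h : w ∈ words X, color ⟨w, h⟩ = k :=
      ((memH p).1 hpH 0).mono fun w hw => ⟨_, tailWords_subset_words X 0 hw, rfl⟩
    exact Ultrafilter.eventually_exists_iff.1 h
  obtain ⟨w, hwD, hw⟩ := exists_sequence_of_absorbing hlin hp hk hpD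
  refine ⟨w, fun s hs => ?_, hwD, k, hw⟩
  -- The empty product is separate: it has no multiplier equal to `1`.
  rcases s with _ | ⟨i, s⟩
  · exact ⟨[], by simp⟩
  · have hcomb : combination w ((i :: s).map fun j => (j, (1 : M))) = (i :: s).flatMap w := by
      simp [combination, List.flatMap_map]
    obtain ⟨h, -⟩ := hw ((i :: s).map fun j => (j, (1 : M))) (List.pairwise_map.2 hs)
      ⟨(i, 1), by simp, rfl⟩
    exact hcomb ▸ h

end Ultrafilters

/-! ### Failure of the Ramsey property without linearity -/

section Nonlinear

variable {M : Type u} [Monoid M]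

theorem smul_mk (b a : M) : b • XM.mk a = XM.mk (b * a) :=
  Subtype.ext (image_principalRight b a)

theorem smul_le_mk (b : M) (s : XM M) : b • s ≤ XM.mk b := by
  obtain ⟨_, a, rfl⟩ := s
  change b • XM.mk a ≤ XM.mk b
  rw [smul_mk]
  exact principalRight_subset ⟨a, rfl⟩

theorem isPointedMSet_XM : IsPointedMSet M (Set.univ : Set (XM M)) (XM.mk 1) := by
  refine Set.eq_univ_of_forall fun s => ?_
  obtain ⟨_, a, rfl⟩ := s
  exact ⟨a, by simp only [smul_mk, mul_one]; rfl⟩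

open Classical in
/-- If `𝕏(M)` is not linear, then no sequence of pointed sets that maps equivariantly to `𝕏(M)`,
with distinguished points going to `1M`, has the Ramsey property. -/
theorem not_hasRamseyProperty {Ω : Type v} [MulAction M Ω] {X : ℕ → Set Ω} {x : ℕ → Ω}
    (f : Ω → XM M) (hf : ∀ (a : M) y, f (a • y) = a • f y) (hx : ∀ n, f (x n) = XM.mk 1)
    (hlin : ¬ XMIsLinear M) : ¬ HasRamseyProperty M X x := by
  intro hR
  unfold XMIsLinear at hlin
  push Not at hlin
  obtain ⟨⟨_, a, rfl⟩, ⟨_, b, rfl⟩, hab, hba⟩ := hlin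
  change ¬ XM.mk a ≤ XM.mk b at hab
  change ¬ XM.mk b ≤ XM.mk a at hba
  let first : List Ω → Option (XM M) := fun w =>
    (w.map f).find? fun s => s = XM.mk a ∨ s = XM.mk b
  obtain ⟨w, -, hw, k, hk⟩ := hR 2 fun w => if first w = some (XM.mk a) then 0 else 1
  -- All entries of `c(w 0)` map below `cM`, and the distinguished one maps to `cM`; so `dM` cannot
  -- occur there. The factor `(1, 1)` only supplies the required multiplier `1`.
  have hcomb : ∀ c d : M, ¬ XM.mk d ≤ XM.mk c → (∀ s, (s = XM.mk a ∨ s = XM.mk b) ↔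
      (s = XM.mk c ∨ s = XM.mk d)) → first (combination w [(0, c), (1, 1)]) = some (XM.mk c) := by
    intro c d hdc hs
    have hfind : ((w 0).map fun y => c • f y).find? (fun s => s = XM.mk a ∨ s = XM.mk b) =
        some (XM.mk c) := by
      obtain ⟨n, hn⟩ := hw 0
      have hmem : XM.mk c ∈ (w 0).map fun y => c • f y :=
        List.mem_map.2 ⟨x n, hn, by rw [hx, smul_mk, mul_one]⟩
      cases hopt : ((w 0).map fun y => c • f y).find? (fun s => s = XM.mk a ∨ s = XM.mk b) with
      | none =>
        have h := List.find?_eq_none.1 hopt _ hmem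
        simp only [decide_eq_true_eq] at h
        exact absurd ((hs _).2 (Or.inl rfl)) h
      | some t =>
        have h1 := List.find?_some hopt
        simp only [decide_eq_true_eq] at h1
        rcases (hs t).1 h1 with h | h
        · rw [h]
        · obtain ⟨y, -, hy⟩ := List.mem_map.1 (List.mem_of_find?_eq_some hopt)
          exact absurd (h ▸ hy ▸ smul_le_mk c (f y)) hdc
    have hmap : (combination w [(0, c), (1, 1)]).map f =
        ((w 0).map fun y => c • f y) ++ (w 1).map f := by
      simp [combination, hf]
    simp only [first]
    rw [hmap, List.find?_append, hfind, Option.some_or]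
  obtain ⟨h1, hk1⟩ := hk [(0, a), (1, 1)] (by simp) (by simp)
  obtain ⟨h2, hk2⟩ := hk [(0, b), (1, 1)] (by simp) (by simp)
  have hne : XM.mk b ≠ XM.mk a := fun h => hba h.le
  rw [← hk2] at hk1
  simp [hcomb a b hba fun s => Iff.rfl, hcomb b a hab fun s => or_comm, hne] at hk1

theorem linear_of_isRamsey [Finite M] (h : IsRamsey.{u, v} M) : XMIsLinear M := by
  by_contra hlin
  have : Finite (XM M) := inferInstanceAs (Finite {s : Set M // ∃ a : M, principalRight a = s})
  -- `IsRamsey` ranges over universe `v`; finiteness allows a copy of `𝕏(M)` there.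
  let e : Shrink.{v} (XM M) ≃ XM M := (equivShrink.{v} (XM M)).symm
  let _ : MulAction M (Shrink.{v} (XM M)) := e.mulAction M
  have he : ∀ (a : M) y, e (a • y) = a • e y := fun a y => e.apply_symm_apply _
  exact not_hasRamseyProperty e he (fun _ => e.apply_symm_apply _) hlin
    (h _ (fun _ => MulAction.orbit M (e.symm (XM.mk 1))) (fun _ => e.symm (XM.mk 1)) fun _ => rfl)

end Nonlinear

end RamseyMonoid

theorem corollary4p6 (M : Type u) [Monoid M] [Finite M] :
    (RamseyMonoid.AlmostRTrivial M → RamseyMonoid.XMIsLinear M →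
      RamseyMonoid.IsRamsey.{u, v} M) ∧
    (¬ RamseyMonoid.XMIsLinear M →
      RamseyMonoid.IsPointedMSet M (Set.univ : Set (RamseyMonoid.XM M)) (RamseyMonoid.XM.mk 1) ∧
      ¬ RamseyMonoid.HasRamseyProperty M (fun _ : ℕ => (Set.univ : Set (RamseyMonoid.XM M)))
        (fun _ : ℕ => RamseyMonoid.XM.mk 1)) ∧
    (RamseyMonoid.AlmostRTrivial M →
      (RamseyMonoid.IsRamsey.{u, v} M ↔ RamseyMonoid.XMIsLinear M)) := by
  refine ⟨RamseyMonoid.isRamsey_of_linear, fun hlin => ⟨RamseyMonoid.isPointedMSet_XM, ?_⟩,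
    fun hM => ⟨RamseyMonoid.linear_of_isRamsey, RamseyMonoid.isRamsey_of_linear hM⟩⟩
  exact RamseyMonoid.not_hasRamseyProperty id (fun _ _ => rfl) (fun _ => rfl) hlin
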